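/- Let $L$ be a first-order language of arbitrary cardinality and let $T$ be a universal theory in $L$ (a set of universal sentences). Call a model $\mathfrak A$ strictly $\kappa$-generated if $\kappa$ is the minimum of the cardinalities of the generating sets of $\mathfrak A$, where $X\subseteq A$ is a generating set if the submodel of $\mathfrak A$ generated by $X$ is $\mathfrak A$ itself. Suppose that for some uncountable cardinal $\kappa$ the theory $T$ is $\kappa$-unique, that is, $T$ has, up to isomorphism, exactly one strictly $\kappa$-generated model. Let $T_\infty$ be the theory of the infinite models of $T$, that is, the set of all sentences of $L$ that are true in every infinite model of $T$. Then $T_\infty$ is complete: it is consistent, and for every sentence $\varphi$ of $L$, either $\varphi$ or $\neg\varphi$ is a consequence of $T_\infty$. -/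

import Mathlib

universe u v w

open FirstOrder Cardinal

namespace FirstOrder.Language

/-- `M` is strictly `κ`-generated: `κ` is the minimum of the cardinalities of the generating sets
of `M`. -/
def IsStrictlyGenerated (L : Language.{u, v}) (M : Type w) [L.Structure M]
    (κ : Cardinal.{w}) : Prop :=
  IsLeast {c : Cardinal.{w} | ∃ X : Set M, Substructure.closure L X = ⊤ ∧ #X = c} κ

namespace Theory

/-- `T` is `κ`-unique: up to isomorphism, it has exactly one strictly `κ`-generated model.
Every strictly `κ`-generated structure has cardinality at most that of `κ`, `ℵ₀` and the set of
function symbols of `L` together, so the universe `max u v w` contains a copy of each of them. -/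
def IsUniqueInPower {L : Language.{u, v}} (T : L.Theory) (κ : Cardinal.{max u v w}) : Prop :=
  ∃ M : ModelType.{u, v, max u v w} T, L.IsStrictlyGenerated M κ ∧
    ∀ N : ModelType.{u, v, max u v w} T, L.IsStrictlyGenerated N κ → Nonempty (N ≃[L] M)

/-- The theory `T_∞` of the infinite models of `T`: the set of all sentences that hold in every
infinite model of `T`. By the Löwenheim-Skolem theorem, the models in the universe `max u v`
decide this. -/
def theoryOfInfiniteModels {L : Language.{u, v}} (T : L.Theory) : L.Theory :=
  {φ : L.Sentence | ∀ M : ModelType.{u, v, max u v} T, Infinite M → M ⊨ φ}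

end Theory

end FirstOrder.Language

/-!
# Completeness of the theory of infinite models of a `κ`-unique universal theory

Let `M` be the strictly `κ`-generated model of `T`. Every infinite model `A` of `T` is elementarily
equivalent to `M`; this needs an argument beyond the Łoś-Vaught test since `κ` may be smaller than
the cardinality of the language `L`, so that an `L`-structure with `κ` generators cannot be closed
under Skolem functions for `L`.

Fix a dense linear order `I` without end points, of cardinality `κ`, and an ultrafilter on `I → A`
for which the coordinates are order-indiscernible and distinct (`exists_isOrderIndiscernible`). In
the ultrapower of `A`, a set `F` of finitary operations on `A` generates, together with the functions
of `L`, a substructure `span F W` over each set `W` of coordinates. It is a model of `T`, because `T`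
is universal. If `F` contains the identity and has at most `κ` elements, then `span F I` is strictly
`κ`-generated (`isStrictlyGenerated_span`), hence isomorphic to `M`. So it suffices to find, for a
given quantifier depth, a countable `F` such that `span F I` is elementary in the ultrapower for
formulas of that depth (`exists_isTarskiVaught`).

This is done by induction on the depth. If no countable `F` works at depth `n + 1`, then iterating
along `ω₁` gives an increasing chain of countable sets `F_δ` that are good at depth `n`, such that a
witness which is missing from `span F_δ I` is provided by an operation in the next set of the chain.
Let `F` be the union of the chain. As `span F I` is isomorphic to the span of the identity alone,
closing off under this isomorphism (`exists_closed_of_equiv`) produces a countable `δ` and a dense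
suborder `W` of `I` such that `span F_δ W` corresponds to the span of the identity over `W`. By
back-and-forth on finite subsets of dense orders (`realize_span_iff`) the latter is an elementary
substructure of the span of the identity over `I`, so `span F_δ W` is elementary in `span F I`
(`realize_iff_of_equiv`). By goodness at depth `n`, the missing witness then exists in `span F_δ W`,
a contradiction.
-/

/-! ### Ultrafilters with order-indiscernible coordinates -/

namespace Ultrafilter

variable {A : Type*} {I : Type*}

open Classical in
/-- The law of a point `ω : I → A` whose coordinates along the list `l` are drawn one after the
other from the ultrafilter `U`, the head of `l` outermost, and whose other coordinates are those
of `ω₀`. -/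
noncomputable def sample (U : Ultrafilter A) (ω₀ : I → A) : List I → Ultrafilter (I → A)
  | [] => pure ω₀
  | i :: l => U.bind fun x => (sample U ω₀ l).map fun ω => Function.update ω i x

variable (U : Ultrafilter A) (ω₀ : I → A)

open Classical in
theorem eventually_sample_cons (i : I) (l : List I) (P : (I → A) → Prop) :
    (∀ᶠ ω in (sample U ω₀ (i :: l) : Filter (I → A)), P ω) ↔
      ∀ᶠ x in (U : Filter A), ∀ᶠ ω in (sample U ω₀ l : Filter (I → A)),
        P (Function.update ω i x) :=
  Iff.rfl

theorem eventually_sample_nil (P : (I → A) → Prop) :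
    (∀ᶠ ω in (sample U ω₀ [] : Filter (I → A)), P ω) ↔ P ω₀ :=
  Iff.rfl

open Classical in
theorem dependsOn_update {P : (I → A) → Prop} {i : I} {l : List I}
    (hP : DependsOn P {j | j ∈ i :: l}) (x : A) :
    DependsOn (fun ω => P (Function.update ω i x)) {j | j ∈ l} := by
  intro ω ω' h
  refine hP fun j hj => ?_
  by_cases hji : j = i
  · subst hji; simp
  · simp only [Function.update_of_ne hji]
    exact h j ((List.mem_cons.1 hj).resolve_left hji)

/-- The coordinates along a sublist have the same law as if only they had been drawn. -/
theorem eventually_sample_of_sublist {l l' : List I} (h : l.Sublist l') (hl' : l'.Nodup)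
    {P : (I → A) → Prop} (hP : DependsOn P {j | j ∈ l}) :
    (∀ᶠ ω in (sample U ω₀ l' : Filter (I → A)), P ω) ↔
      ∀ᶠ ω in (sample U ω₀ l : Filter (I → A)), P ω := by
  classical
  induction h generalizing P with
  | slnil => rfl
  | @cons l l' a h ih =>
    have ha : a ∉ l := fun ha => (List.nodup_cons.1 hl').1 (h.subset ha)
    have key : ∀ x ω, P (Function.update ω a x) = P ω := fun x ω =>
      hP fun j hj => Function.update_of_ne (by rintro rfl; exact ha hj) _ _
    rw [eventually_sample_cons]
    simp only [key, Filter.eventually_const]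
    exact ih (List.nodup_cons.1 hl').2 hP
  | @cons_cons l l' a h ih =>
    rw [eventually_sample_cons, eventually_sample_cons]
    simp only [ih (List.nodup_cons.1 hl').2 (dependsOn_update hP _)]

/-- The law of the drawn coordinates does not depend on their names. -/
theorem eventually_sample_map {l : List I} {h : I → I} (hl : (l.map h).Nodup)
    {P : (I → A) → Prop} (hP : DependsOn P {j | j ∈ l}) :
    (∀ᶠ ω in (sample U ω₀ (l.map h) : Filter (I → A)), P (ω ∘ h)) ↔
      ∀ᶠ ω in (sample U ω₀ l : Filter (I → A)), P ω := by
  classical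
  induction l generalizing P with
  | nil =>
    rw [List.map_nil, eventually_sample_nil, eventually_sample_nil]
    exact iff_of_eq (hP fun j hj => absurd hj (by simp))
  | cons a l ih =>
    rw [List.map_cons, List.nodup_cons] at hl
    rw [List.map_cons, eventually_sample_cons, eventually_sample_cons]
    refine Filter.eventually_congr (Filter.Eventually.of_forall fun x => ?_)
    rw [← ih hl.2 (dependsOn_update hP x)]
    refine iff_of_eq (congrArg (fun Q => ∀ᶠ ω in (sample U ω₀ (l.map h) : Filter (I → A)), Q ω)
      (funext fun ω => hP fun j hj => ?_))
    by_cases hja : j = a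
    · subst hja; simp
    · have hjl : j ∈ l := (List.mem_cons.1 hj).resolve_left hja
      have hne : h j ≠ h a := fun e => hl.1 (e ▸ List.mem_map_of_mem hjl)
      simp [Function.update_of_ne hja, Function.update_of_ne hne]

end Ultrafilter

/-- An ultrafilter on `I → A` is order-indiscernible if the truth of a property of finitely many
coordinates is not affected by an order preserving change of these coordinates, and no two
coordinates agree almost everywhere. -/
structure IsOrderIndiscernible {A I : Type*} [LinearOrder I] (V : Ultrafilter (I → A)) : Prop where
  eventually_comp : ∀ (s : Finset I) (h : I → I), StrictMonoOn h s →
    ∀ P : (I → A) → Prop, DependsOn P s →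
      ((∀ᶠ ω in (V : Filter (I → A)), P (ω ∘ h)) ↔ ∀ᶠ ω in (V : Filter (I → A)), P ω)
  eventually_ne : ∀ i j, i ≠ j → ∀ᶠ ω in (V : Filter (I → A)), ω i ≠ ω j

/-- Drawing the coordinates in a larger and larger finite set from a nonprincipal ultrafilter,
in increasing order of their indices, gives an order-indiscernible ultrafilter in the limit. -/
theorem exists_isOrderIndiscernible (A I : Type*) [Infinite A] [LinearOrder I] :
    ∃ V : Ultrafilter (I → A), IsOrderIndiscernible V := by
  classical
  let U : Ultrafilter A := Filter.hyperfilter A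
  let ω₀ : I → A := fun _ => Classical.arbitrary A
  let G : Ultrafilter (Finset I) := Ultrafilter.of Filter.atTop
  let V : Ultrafilter (I → A) := G.bind fun t => Ultrafilter.sample U ω₀ t.sort
  have key : ∀ (l : List I), l.Pairwise (· < ·) → ∀ P : (I → A) → Prop,
      DependsOn P {j | j ∈ l} → ((∀ᶠ ω in (V : Filter (I → A)), P ω) ↔
        ∀ᶠ ω in (Ultrafilter.sample U ω₀ l : Filter (I → A)), P ω) := by
    intro l hl P hP
    have hV : (∀ᶠ ω in (V : Filter (I → A)), P ω) ↔ ∀ᶠ t in (G : Filter (Finset I)),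
        ∀ᶠ ω in (Ultrafilter.sample U ω₀ t.sort : Filter (I → A)), P ω := Iff.rfl
    rw [hV]
    have hG : ∀ᶠ t in (G : Filter (Finset I)), l.toFinset ⊆ t :=
      Ultrafilter.of_le Filter.atTop (Filter.eventually_ge_atTop l.toFinset)
    have : ∀ᶠ t in (G : Filter (Finset I)),
        ((∀ᶠ ω in (Ultrafilter.sample U ω₀ t.sort : Filter (I → A)), P ω) ↔
          ∀ᶠ ω in (Ultrafilter.sample U ω₀ l : Filter (I → A)), P ω) := by
      filter_upwards [hG] with t ht
      refine Ultrafilter.eventually_sample_of_sublist U ω₀ ?_ (Finset.sort_nodup _ _) hP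
      refine List.sublist_of_subperm_of_pairwise (r := (· ≤ ·)) ?_ (hl.imp le_of_lt)
        (Finset.pairwise_sort _ _)
      refine List.subperm_of_subset (hl.imp ne_of_lt) fun i hi => ?_
      exact (Finset.mem_sort _).2 (ht (List.mem_toFinset.2 hi))
    rw [Filter.eventually_congr this, Filter.eventually_const]
  have hmem : ∀ s : Finset I, {j | j ∈ s.sort} = (s : Set I) := fun s => by ext; simp
  refine ⟨V, ⟨fun s h hh P hP => ?_, ?_⟩⟩
  · have hs : s.sort.Pairwise (· < ·) := s.sortedLT_sort.pairwise
    have hs' : (s.sort.map h).Pairwise (· < ·) := by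
      refine List.pairwise_map.2 (hs.imp_of_mem fun {a b} ha hb hab => ?_)
      exact hh (by simpa using ha) (by simpa using hb) hab
    rw [← hmem] at hP
    rw [key _ hs P hP, key _ hs', Ultrafilter.eventually_sample_map U ω₀ (hs'.imp ne_of_lt) hP]
    intro ω ω' hω
    exact hP fun j hj => hω _ (List.mem_map_of_mem hj)
  · suffices H : ∀ i j, i < j → ∀ᶠ ω in (V : Filter (I → A)), ω i ≠ ω j by
      intro i j hij
      rcases lt_or_gt_of_ne hij with h | h
      · exact H i j h
      · exact (H j i h).mono fun ω hω => hω.symm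
    intro i j hij
    rw [key [i, j] (by simpa using hij)]
    · rw [Ultrafilter.eventually_sample_cons]
      refine Filter.Eventually.of_forall fun x => ?_
      rw [Ultrafilter.eventually_sample_cons]
      have hx : ∀ᶠ y in (U : Filter A), y ≠ x := by
        have : ({x}ᶜ : Set A) ∈ (U : Filter A) :=
          Filter.compl_mem_hyperfilter_of_finite (Set.finite_singleton x)
        exact this
      filter_upwards [hx] with y hy
      rw [Ultrafilter.eventually_sample_nil]
      simpa [hij.ne'] using hy.symm
    · intro ω ω' h
      simp only [h i (by simp), h j (by simp)]

/-! ### Extending finite order preserving maps -/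

namespace Set

/-- `W` is dense in itself and has no end points, in the form used for finite back-and-forth: any
two finite subsets of `W`, one below the other, are separated by a point of `W`. -/
def SeparatesFinsets {I : Type*} [LinearOrder I] (W : Set I) : Prop :=
  ∀ lo hi : Finset I, ↑lo ⊆ W → ↑hi ⊆ W → (∀ x ∈ lo, ∀ y ∈ hi, x < y) →
    ∃ m ∈ W, (∀ x ∈ lo, x < m) ∧ ∀ y ∈ hi, m < y

theorem separatesFinsets_univ {I : Type*} [LinearOrder I] [DenselyOrdered I] [NoMinOrder I]
    [NoMaxOrder I] [Nonempty I] : (univ : Set I).SeparatesFinsets := by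
  intro lo hi _ _ h
  obtain ⟨m, hm, hm'⟩ := Order.exists_between_finsets lo hi h
  exact ⟨m, mem_univ m, hm, hm'⟩

variable {I : Type*} [LinearOrder I] {W : Set I}

/-- An order preserving map from a finite set into a dense suborder extends to finitely many more
points. -/
theorem SeparatesFinsets.exists_extend (hW : W.SeparatesFinsets) (s t : Finset I) (h : I → I)
    (hh : StrictMonoOn h s) (hhW : ∀ i ∈ s, h i ∈ W) :
    ∃ c : I → I, StrictMonoOn c (s ∪ t : Finset I) ∧ (∀ i ∈ s, c i = h i) ∧
      ∀ i ∈ s ∪ t, c i ∈ W := by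
  classical
  induction t using Finset.induction_on with
  | empty => exact ⟨h, by simpa using hh, fun _ _ => rfl, by simpa using hhW⟩
  | insert x t hx ih =>
    obtain ⟨c, hc, hcs, hcW⟩ := ih
    by_cases hxs : x ∈ s ∪ t
    · have : s ∪ insert x t = s ∪ t := by
        rw [Finset.union_insert, Finset.insert_eq_of_mem hxs]
      rw [this]
      exact ⟨c, hc, hcs, hcW⟩
    obtain ⟨m, hmW, hlo, hhi⟩ := hW (((s ∪ t).filter (· < x)).image c)
      (((s ∪ t).filter (x < ·)).image c)
      (fun y hy => by
        simp only [Finset.coe_image, mem_image, Finset.mem_coe, Finset.mem_filter] at hy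
        obtain ⟨i, hi, rfl⟩ := hy
        exact hcW i hi.1)
      (fun y hy => by
        simp only [Finset.coe_image, mem_image, Finset.mem_coe, Finset.mem_filter] at hy
        obtain ⟨i, hi, rfl⟩ := hy
        exact hcW i hi.1)
      (fun y hy z hz => by
        simp only [Finset.mem_image, Finset.mem_filter] at hy hz
        obtain ⟨i, hi, rfl⟩ := hy
        obtain ⟨j, hj, rfl⟩ := hz
        exact hc (Finset.mem_coe.2 hi.1) (Finset.mem_coe.2 hj.1) (hi.2.trans hj.2))
    have hlo' : ∀ i ∈ s ∪ t, i < x → c i < m := fun i hi hix =>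
      hlo _ (Finset.mem_image_of_mem c (Finset.mem_filter.2 ⟨hi, hix⟩))
    have hhi' : ∀ i ∈ s ∪ t, x < i → m < c i := fun i hi hix =>
      hhi _ (Finset.mem_image_of_mem c (Finset.mem_filter.2 ⟨hi, hix⟩))
    have hne : ∀ i ∈ s ∪ t, i ≠ x := fun i hi e => hxs (e ▸ hi)
    refine ⟨Function.update c x m, ?_, fun i hi => ?_, fun i hi => ?_⟩
    · intro i hi j hj hij
      rw [Finset.union_insert, Finset.mem_coe, Finset.mem_insert] at hi hj
      rcases hi with rfl | hi <;> rcases hj with rfl | hj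
      · exact absurd hij (lt_irrefl _)
      · simpa [hne j hj] using hhi' j hj hij
      · simpa [hne i hi] using hlo' i hi hij
      · simpa [hne i hi, hne j hj] using hc (Finset.mem_coe.2 hi) (Finset.mem_coe.2 hj) hij
    · rw [Function.update_of_ne (hne i (Finset.mem_union_left _ hi)), hcs i hi]
    · rw [Finset.union_insert, Finset.mem_insert] at hi
      rcases hi with rfl | hi
      · simpa using hmW
      · simpa [hne i hi] using hcW i hi

/-- The extension step of back-and-forth: if `a` and `b` carry `s` to two finite suborders, then
the order isomorphism from the first to the second extends to finitely many more points. -/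
theorem SeparatesFinsets.exists_extend_comp (hW : W.SeparatesFinsets)
    (s t : Finset I) (a b : I → I)
    (ha : StrictMonoOn a s) (hb : StrictMonoOn b s) (hbW : ∀ i ∈ s, b i ∈ W) :
    ∃ c : I → I, StrictMonoOn c (s.image a ∪ t : Finset I) ∧ (∀ i ∈ s, c (a i) = b i) ∧
      ∀ i ∈ s.image a ∪ t, c i ∈ W := by
  have : Nonempty I := (hW ∅ ∅ (by simp) (by simp) (by simp)).nonempty
  have hinv : ∀ i ∈ s, Function.invFunOn a s (a i) = i := fun i hi =>
    ha.injOn (Function.invFunOn_mem ⟨i, hi, rfl⟩) hi (Function.invFunOn_eq ⟨i, hi, rfl⟩)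
  have hmono : StrictMonoOn (fun i => b (Function.invFunOn a s i)) (s.image a : Finset I) := by
    intro x hx y hy hxy
    obtain ⟨i, hi, rfl⟩ := Finset.mem_image.1 hx
    obtain ⟨j, hj, rfl⟩ := Finset.mem_image.1 hy
    simp only [hinv i hi, hinv j hj]
    exact hb hi hj ((ha.lt_iff_lt hi hj).1 hxy)
  have hmem : ∀ x ∈ s.image a, b (Function.invFunOn a s x) ∈ W := by
    intro x hx
    obtain ⟨i, hi, rfl⟩ := Finset.mem_image.1 hx
    simp only [hinv i hi]
    exact hbW i hi
  obtain ⟨c, hc, hc', hcW⟩ := hW.exists_extend (s.image a) t _ hmono hmem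
  refine ⟨c, hc, fun i hi => ?_, hcW⟩
  rw [hc' _ (Finset.mem_image_of_mem a hi), hinv i hi]

end Set

namespace FirstOrder.Language

/-! ### Submodels of the ultrapower generated by indiscernibles -/

section Ultrapower

universe z

variable (L : Language.{u, v}) {A I : Type z} [L.Structure A]

/-- The element of the ultrapower of `A` by `V` with representative `G`. -/
def toUltrapower (V : Ultrafilter (I → A)) (G : (I → A) → A) :
    (V : Filter (I → A)).Product fun _ => A :=
  Quotient.mk' (s := (V : Filter (I → A)).productSetoid fun _ => A) G

variable (V : Ultrafilter (I → A))

theorem exists_toUltrapower_eq (x : (V : Filter (I → A)).Product fun _ => A) :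
    ∃ G, x = toUltrapower V G :=
  Quotient.inductionOn' x fun G => ⟨G, rfl⟩

theorem toUltrapower_eq_iff {G G' : (I → A) → A} :
    toUltrapower V G = toUltrapower V G' ↔ ∀ᶠ ω in (V : Filter (I → A)), G ω = G' ω :=
  Quotient.eq''

/-- For a set `F` of finitary operations on `A`, the substructure of the ultrapower generated by
the elements `f (i₁, …, iₙ)` with `f ∈ F` and `i₁, …, iₙ ∈ W`, where an index `i : I` stands for
the element represented by the `i`-th coordinate. Operations take lists as arguments, so that
those of all arities are collected in one type. -/
def span (F : Set (List A → A)) (W : Set I) :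
    L.Substructure ((V : Filter (I → A)).Product fun _ => A) :=
  Substructure.closure L
    {x | ∃ f ∈ F, ∃ l : List I, (∀ i ∈ l, i ∈ W) ∧ x = toUltrapower V fun ω => f (l.map ω)}

variable {L} in
theorem funMap_toUltrapower {n : ℕ} (g : L.Functions n) (G : Fin n → (I → A) → A) :
    Structure.funMap g (fun k => toUltrapower V (G k)) =
      toUltrapower V fun ω => Structure.funMap g fun k => G k ω :=
  Ultraproduct.funMap_cast (M := fun _ => A) (u := V) g G

variable {L V} {F F' : Set (List A → A)} {W W' : Set I}

theorem toUltrapower_mem_span {f : List A → A} (hf : f ∈ F) {l : List I} (hl : ∀ i ∈ l, i ∈ W) :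
    (toUltrapower V fun ω => f (l.map ω)) ∈ span L V F W :=
  Substructure.subset_closure ⟨f, hf, l, hl, rfl⟩

theorem span_mono (hF : F ⊆ F') (hW : W ⊆ W') : span L V F W ≤ span L V F' W' :=
  Substructure.closure_mono fun _ ⟨f, hf, l, hl, hx⟩ => ⟨f, hF hf, l, fun i hi => hW (hl i hi), hx⟩

variable (L V F) in
/-- `G` is built from the operations in `F`, the functions of `L` and the coordinates in `s`. The
second clause says so in a way that is visibly stable under renaming the coordinates. -/
def IsTermOver (s : Finset I) (G : (I → A) → A) : Prop :=
  DependsOn G s ∧ ∀ h : I → I, (toUltrapower V fun ω => G (ω ∘ h)) ∈ span L V F (h '' s)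

theorem IsTermOver.mono {s t : Finset I} {G : (I → A) → A} (hG : IsTermOver L V F s G)
    (hF : F ⊆ F') (hst : s ⊆ t) : IsTermOver L V F' t G :=
  ⟨fun _ _ h => hG.1 fun i hi => h i (hst hi), fun h =>
    span_mono hF (Set.image_mono (Finset.coe_subset.2 hst)) (hG.2 h)⟩

theorem IsTermOver.comp [DecidableEq I] {s : Finset I} {G : (I → A) → A}
    (hG : IsTermOver L V F s G) (h : I → I) :
    IsTermOver L V F (s.image h) fun ω => G (ω ∘ h) := by
  refine ⟨fun ω ω' hω => hG.1 fun i hi => hω _ ?_, fun g => ?_⟩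
  · exact Finset.mem_coe.2 (Finset.mem_image_of_mem h hi)
  · have := hG.2 (g ∘ h)
    rw [Set.image_comp] at this
    rw [Finset.coe_image]
    exact this

theorem IsTermOver.comp_mem_span {s : Finset I} {G : (I → A) → A} (hG : IsTermOver L V F s G)
    {h : I → I} (hh : ∀ i ∈ s, h i ∈ W) : (toUltrapower V fun ω => G (ω ∘ h)) ∈ span L V F W :=
  span_mono subset_rfl (Set.image_subset_iff.2 hh) (hG.2 h)

theorem IsTermOver.mem_span {s : Finset I} {G : (I → A) → A} (hG : IsTermOver L V F s G)
    (hs : ↑s ⊆ W) : toUltrapower V G ∈ span L V F W :=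
  hG.comp_mem_span (h := id) hs

/-- Every element of a span has a finite support. -/
theorem exists_isTermOver {x : (V : Filter (I → A)).Product fun _ => A}
    (hx : x ∈ span L V F W) :
    ∃ s : Finset I, ↑s ⊆ W ∧ ∃ G, IsTermOver L V F s G ∧ x = toUltrapower V G := by
  classical
  refine Substructure.closure_induction (p := fun x => ∃ s : Finset I, ↑s ⊆ W ∧ ∃ G,
    IsTermOver L V F s G ∧ x = toUltrapower V G) hx ?_ ?_
  · rintro x ⟨f, hf, l, hl, rfl⟩
    refine ⟨l.toFinset, fun i hi => hl i (by simpa using hi), fun ω => f (l.map ω),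
      ⟨fun ω ω' h => ?_, fun h => ?_⟩, rfl⟩
    · exact congrArg f (List.map_congr_left fun i hi => h i (by simpa using hi))
    · have := toUltrapower_mem_span (L := L) (V := V) hf (l := l.map h) (W := h '' l.toFinset)
        (by simp)
      simpa [List.map_map] using this
  · intro n g x hx
    choose s hs G hG hxG using hx
    refine ⟨Finset.univ.biUnion s, ?_, fun ω => Structure.funMap g fun k => G k ω,
      ⟨fun ω ω' h => ?_, fun h => ?_⟩, ?_⟩
    · intro i hi
      simp only [Finset.coe_biUnion, Set.mem_iUnion] at hi
      obtain ⟨k, -, hi⟩ := hi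
      exact hs k hi
    · refine congrArg _ (funext fun k => (hG k).1 fun i hi => h i ?_)
      exact Finset.mem_coe.2 (Finset.mem_biUnion.2 ⟨k, Finset.mem_univ k, hi⟩)
    · have := (span L V F (h '' (Finset.univ.biUnion s : Finset I))).fun_mem g
        (fun k => toUltrapower V fun ω => G k (ω ∘ h)) fun k => (hG k).comp_mem_span fun i hi =>
          Set.mem_image_of_mem h
            (Finset.mem_coe.2 (Finset.mem_biUnion.2 ⟨k, Finset.mem_univ k, hi⟩))
      rw [funMap_toUltrapower] at this
      exact this
    · rw [show x = fun k => toUltrapower V (G k) from funext hxG]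
      exact funMap_toUltrapower V g G

/-- Łoś's theorem for representatives. -/
theorem realize_toUltrapower [Nonempty A] {m : ℕ} (φ : L.BoundedFormula Empty m)
    (G : Fin m → (I → A) → A) :
    φ.Realize default (fun k => toUltrapower V (G k)) ↔
      ∀ᶠ ω in (V : Filter (I → A)), φ.Realize default fun k => G k ω := by
  have := Ultraproduct.boundedFormula_realize_cast (M := fun _ => A) (u := V) φ
    (fun i => i.elim) G
  have e : ∀ (B : Type z) (x : Empty → B), x = default := fun B x => Subsingleton.elim _ _
  simp only [e] at this
  exact this

variable [LinearOrder I]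

/-- Indiscernibility of the coordinates, carried to the ultrapower by Łoś's theorem. -/
theorem realize_toUltrapower_comp [Nonempty A] (hV : IsOrderIndiscernible V) {m : ℕ}
    (φ : L.BoundedFormula Empty m) {s : Finset I} {G : Fin m → (I → A) → A}
    (hG : ∀ k, DependsOn (G k) s) {h : I → I} (hh : StrictMonoOn h s) :
    φ.Realize default (fun k => toUltrapower V fun ω => G k (ω ∘ h)) ↔
      φ.Realize default (fun k => toUltrapower V (G k)) := by
  rw [realize_toUltrapower, realize_toUltrapower]
  refine hV.eventually_comp s h hh (fun ω => φ.Realize default fun k => G k ω) ?_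
  intro ω ω' hω
  simp only [fun k => hG k hω]

/-- Over a dense order of size `κ`, the span of at most `κ` operations, with the identity among
them, is strictly `κ`-generated. Fewer than `κ` elements are supported by fewer than `κ` indices, and
they do not generate the element of any other index, since that index can be moved to a different
one while the arguments of a given term stay fixed. -/
theorem isStrictlyGenerated_span [DenselyOrdered I] [NoMinOrder I] [NoMaxOrder I] [Nonempty I]
    [Nonempty A] (hV : IsOrderIndiscernible V)
    {κ : Cardinal.{z}} (hκ : ℵ₀ < κ) (hI : #I = κ) (hF : #F ≤ κ)
    (hhead : ∃ f ∈ F, ∀ x, f [x] = x) :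
    L.IsStrictlyGenerated (span L V F Set.univ) κ := by
  classical
  have hlow : ∀ Y : Set (span L V F Set.univ), Substructure.closure L Y = ⊤ → κ ≤ #Y := by
    intro Y hY
    by_contra! hlt
    choose s _ G hG hyG using fun y : Y => exists_isTermOver (y : span L V F Set.univ).2
    have hS : #(⋃ y, (s y : Set I)) < #I := by
      rw [hI]
      refine (Cardinal.mk_iUnion_le_sum_mk.trans ?_).trans_lt (Cardinal.mul_lt_of_lt hκ.le hlt hκ)
      refine (Cardinal.sum_le_sum _ (fun _ => ℵ₀) fun y => ?_).trans (by simp)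
      exact Cardinal.mk_le_aleph0
    obtain ⟨i, hi⟩ : ∃ i, i ∉ ⋃ y, (s y : Set I) := by
      by_contra! h
      rw [Set.eq_univ_of_forall h, Cardinal.mk_univ] at hS
      exact lt_irrefl _ hS
    have hle : span L V F Set.univ ≤ span L V F (⋃ y, (s y : Set I)) := by
      have h1 : Substructure.closure L ((span L V F Set.univ).subtype '' Y) ≤
          span L V F (⋃ y, (s y : Set I)) := by
        rw [Substructure.closure_le]
        rintro _ ⟨y, hy, rfl⟩
        have := (hG ⟨y, hy⟩).mem_span (Set.subset_iUnion (fun y => (s y : Set I)) ⟨y, hy⟩)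
        rw [← hyG] at this
        exact this
      refine le_trans ?_ h1
      intro x hx
      have h2 := Substructure.closure_image (L := L) (s := Y) (span L V F Set.univ).subtype.toHom
      rw [hY] at h2
      have h3 : x ∈ Substructure.map (span L V F Set.univ).subtype.toHom ⊤ :=
        ⟨⟨x, hx⟩, trivial, rfl⟩
      rw [← h2] at h3
      exact h3
    obtain ⟨f, hf, hfx⟩ := hhead
    have hwi : (toUltrapower V fun ω => ω i) ∈ span L V F Set.univ := by
      have := toUltrapower_mem_span (L := L) (V := V) hf (l := [i]) (W := Set.univ) (by simp)
      simpa [hfx] using this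
    obtain ⟨t, htS, g, hg, hig⟩ := exists_isTermOver (hle hwi)
    have hit : i ∉ t := fun h => hi (htS h)
    rw [toUltrapower_eq_iff] at hig
    obtain ⟨j, hlo, hhi⟩ := Order.exists_between_finsets (insert i (t.filter (· < i)))
      (t.filter (i < ·)) (fun x hx y hy => by
        rw [Finset.mem_insert, Finset.mem_filter] at hx
        rw [Finset.mem_filter] at hy
        rcases hx with rfl | hx
        · exact hy.2
        · exact hx.2.trans hy.2)
    have hij : i < j := hlo i (Finset.mem_insert_self _ _)
    have hne : ∀ x ∈ t, x ≠ i := fun x hx e => hit (e ▸ hx)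
    have hh : StrictMonoOn (Function.update id i j) (insert i t : Finset I) := by
      intro x hx y hy hxy
      rw [Finset.mem_coe, Finset.mem_insert] at hx hy
      rcases hx with rfl | hx <;> rcases hy with rfl | hy
      · exact absurd hxy (lt_irrefl _)
      · simpa [hne y hy] using hhi y (Finset.mem_filter.2 ⟨hy, hxy⟩)
      · simpa [hne x hx] using hxy.trans hij
      · simpa [hne x hx, hne y hy] using hxy
    have hmove := (hV.eventually_comp (insert i t) _ hh (fun ω => ω i = g ω) (by
      intro ω ω' hω
      simp only
      rw [hω i (by simp), hg.1 fun x hx => hω x (by simp [Finset.mem_coe.1 hx])])).2 hig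
    have hfalse : ∀ᶠ ω in (V : Filter (I → A)), False := by
      filter_upwards [hmove, hig, hV.eventually_ne i j hij.ne] with ω h1 h2 h3
      refine h3 (h2.trans (Eq.trans ?_ (h1.symm.trans (by simp))))
      exact hg.1 fun x hx => by simp [hne x hx]
    exact hfalse.exists.elim fun _ h => h
  let X : Set (span L V F Set.univ) := Set.range fun p : F × List I =>
    ⟨toUltrapower V fun ω => (p.1 : List A → A) (p.2.map ω),
      toUltrapower_mem_span p.1.2 fun _ _ => Set.mem_univ _⟩
  have hX : Substructure.closure L X = ⊤ := by
    refine Substructure.map_injective_of_injective (f := (span L V F Set.univ).subtype.toHom)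
      Subtype.val_injective ?_
    rw [← Substructure.closure_image]
    apply le_antisymm
    · rw [Substructure.closure_le]
      rintro _ ⟨x, -, rfl⟩
      exact ⟨x, trivial, rfl⟩
    · rintro _ ⟨x, -, rfl⟩
      refine Substructure.closure_mono ?_ x.2
      rintro _ ⟨f, hf, l, -, rfl⟩
      exact ⟨_, ⟨⟨⟨f, hf⟩, l⟩, rfl⟩, rfl⟩
  have hXκ : #X ≤ κ := by
    refine Cardinal.mk_range_le.trans ?_
    rw [Cardinal.mk_prod, Cardinal.lift_id, Cardinal.lift_id]
    refine Cardinal.mul_le_of_le hκ.le hF ?_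
    have : Infinite I := Cardinal.infinite_iff.2 (hI ▸ hκ.le)
    rw [Cardinal.mk_list_eq_mk, hI]
  exact ⟨⟨X, hX, le_antisymm hXκ (hlow X hX)⟩, by rintro _ ⟨Y, hY, rfl⟩; exact hlow Y hY⟩

end Ultrapower

end FirstOrder.Language

namespace FirstOrder.Language

/-! ### Back-and-forth between the spans of dense suborders -/

/-- The maximal number of nested quantifiers in a formula. -/
def BoundedFormula.quantifierDepth {L : Language.{u, v}} {α : Type*} :
    ∀ {m : ℕ}, L.BoundedFormula α m → ℕ
  | _, .falsum => 0
  | _, .equal _ _ => 0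
  | _, .rel _ _ => 0
  | _, .imp φ ψ => max φ.quantifierDepth ψ.quantifierDepth
  | _, .all φ => φ.quantifierDepth + 1

section Ultrapower

universe z

variable {L : Language.{u, v}} {A I : Type z} [L.Structure A] {V : Ultrafilter (I → A)}
  {F F' : Set (List A → A)} {W W' : Set I}

theorem realize_isQF_coe {M : Type*} [L.Structure M] (S : L.Substructure M) {m : ℕ}
    {φ : L.BoundedFormula Empty m} (hφ : φ.IsQF) (v : Fin m → S) :
    φ.Realize default v ↔ φ.Realize default fun k => (v k : M) := by
  have := hφ.realize_embedding S.subtype (v := default) (xs := v)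
  rw [← this]
  exact iff_of_eq (congrArg₂ _ (Subsingleton.elim _ _) rfl)

theorem exists_isTermOver_tuple {m : ℕ} {v : Fin m → (V : Filter (I → A)).Product fun _ => A}
    (hv : ∀ k, v k ∈ span L V F W) :
    ∃ s : Finset I, ↑s ⊆ W ∧ ∃ G : Fin m → (I → A) → A,
      (∀ k, IsTermOver L V F s (G k)) ∧ v = fun k => toUltrapower V (G k) := by
  classical
  choose s hs G hG hvG using fun k => exists_isTermOver (hv k)
  refine ⟨Finset.univ.biUnion s, ?_, G, fun k => (hG k).mono subset_rfl ?_, funext hvG⟩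
  · intro i hi
    obtain ⟨k, -, hi⟩ := Finset.mem_biUnion.1 (Finset.mem_coe.1 hi)
    exact hs k hi
  · exact Finset.subset_biUnion_of_mem s (Finset.mem_univ k)

theorem snoc_toUltrapower {m : ℕ} (G : Fin m → (I → A) → A) (g : (I → A) → A) (h : I → I) :
    (fun k => toUltrapower V fun ω => Fin.snoc (α := fun _ => (I → A) → A) G g k (ω ∘ h)) =
      Fin.snoc (α := fun _ => (V : Filter (I → A)).Product fun _ => A)
        (fun k => toUltrapower V fun ω => G k (ω ∘ h)) (toUltrapower V fun ω => g (ω ∘ h)) := by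
  funext k
  refine Fin.lastCases ?_ (fun k => ?_) k <;> simp

/-- Order isomorphic finite subsets of dense suborders of `I` satisfy the same formulas in the
spans of these suborders. -/
theorem realize_span_iff [LinearOrder I] [Nonempty A] (hV : IsOrderIndiscernible V) {m : ℕ}
    (φ : L.BoundedFormula Empty m) :
    ∀ {W W' : Set I}, W.SeparatesFinsets → W'.SeparatesFinsets →
    ∀ (s : Finset I) (G : Fin m → (I → A) → A), (∀ k, IsTermOver L V F s (G k)) →
    ∀ a b : I → I, StrictMonoOn a s → StrictMonoOn b s →
    (∀ i ∈ s, a i ∈ W) → (∀ i ∈ s, b i ∈ W') →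
    ∀ (v : Fin m → span L V F W) (v' : Fin m → span L V F W'),
    (∀ k, (v k : (V : Filter (I → A)).Product fun _ => A) =
      toUltrapower V fun ω => G k (ω ∘ a)) →
    (∀ k, (v' k : (V : Filter (I → A)).Product fun _ => A) =
      toUltrapower V fun ω => G k (ω ∘ b)) →
    (φ.Realize default v ↔ φ.Realize default v') := by
  have hQF : ∀ {m : ℕ} (φ : L.BoundedFormula Empty m), φ.IsQF →
      ∀ {W W' : Set I} (s : Finset I) (G : Fin m → (I → A) → A),
      (∀ k, IsTermOver L V F s (G k)) →
      ∀ a b : I → I, StrictMonoOn a s → StrictMonoOn b s →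
      ∀ (v : Fin m → span L V F W) (v' : Fin m → span L V F W'),
      (∀ k, (v k : (V : Filter (I → A)).Product fun _ => A) =
        toUltrapower V fun ω => G k (ω ∘ a)) →
      (∀ k, (v' k : (V : Filter (I → A)).Product fun _ => A) =
        toUltrapower V fun ω => G k (ω ∘ b)) →
      (φ.Realize default v ↔ φ.Realize default v') := by
    intro m φ hφ W W' s G hG a b ha hb v v' hv hv'
    rw [realize_isQF_coe _ hφ, realize_isQF_coe _ hφ]
    simp only [hv, hv']
    rw [realize_toUltrapower_comp hV φ (fun k => (hG k).1) ha,
      realize_toUltrapower_comp hV φ (fun k => (hG k).1) hb]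
  induction φ with
  | falsum => intros; rfl
  | equal t₁ t₂ =>
    intro W W' _ _ s G hG a b ha hb _ _ v v' hv hv'
    exact hQF _ (BoundedFormula.IsAtomic.equal t₁ t₂).isQF s G hG a b ha hb v v' hv hv'
  | rel R ts =>
    intro W W' _ _ s G hG a b ha hb _ _ v v' hv hv'
    exact hQF _ (BoundedFormula.IsAtomic.rel R ts).isQF s G hG a b ha hb v v' hv hv'
  | imp φ ψ ihφ ihψ =>
    intro W W' hW hW' s G hG a b ha hb haW hbW v v' hv hv'
    rw [BoundedFormula.realize_imp, BoundedFormula.realize_imp,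
      ihφ hW hW' s G hG a b ha hb haW hbW v v' hv hv',
      ihψ hW hW' s G hG a b ha hb haW hbW v v' hv hv']
  | @all m φ ih =>
    have hall : ∀ {W W' : Set I}, W.SeparatesFinsets → W'.SeparatesFinsets →
        ∀ (s : Finset I) (G : Fin m → (I → A) → A), (∀ k, IsTermOver L V F s (G k)) →
        ∀ a b : I → I, StrictMonoOn a s → StrictMonoOn b s →
        (∀ i ∈ s, a i ∈ W) → (∀ i ∈ s, b i ∈ W') →
        ∀ (v : Fin m → span L V F W) (v' : Fin m → span L V F W'),
        (∀ k, (v k : (V : Filter (I → A)).Product fun _ => A) =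
          toUltrapower V fun ω => G k (ω ∘ a)) →
        (∀ k, (v' k : (V : Filter (I → A)).Product fun _ => A) =
          toUltrapower V fun ω => G k (ω ∘ b)) →
        φ.all.Realize default v → φ.all.Realize default v' := by
      intro W W' hW hW' s G hG a b ha hb haW hbW v v' hv hv' H
      rw [BoundedFormula.realize_all] at H ⊢
      intro y'
      obtain ⟨t, ht, g, hg, hyg⟩ := exists_isTermOver y'.2
      obtain ⟨c, hc, hca, hcW⟩ := hW.exists_extend_comp s t b a hb ha haW
      have hy : (toUltrapower V fun ω => g (ω ∘ c)) ∈ span L V F W :=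
        hg.comp_mem_span fun i hi => hcW i (Finset.mem_union_right _ hi)
      refine (ih hW hW' (s.image b ∪ t)
        (Fin.snoc (α := fun _ => (I → A) → A) (fun k ω => G k (ω ∘ b)) g) ?_ c id hc
        (strictMono_id.strictMonoOn _) hcW ?_ (Fin.snoc v ⟨_, hy⟩) _ ?_ ?_).1 (H ⟨_, hy⟩)
      · refine Fin.lastCases ?_ fun k => ?_
        · simpa using hg.mono subset_rfl Finset.subset_union_right
        · simpa using ((hG k).comp b).mono subset_rfl Finset.subset_union_left
      · intro i hi
        rcases Finset.mem_union.1 hi with hi | hi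
        · obtain ⟨j, hj, rfl⟩ := Finset.mem_image.1 hi
          exact hbW j hj
        · exact ht hi
      · refine Fin.lastCases ?_ fun k => ?_
        · simp
        · simp only [Fin.snoc_castSucc, hv]
          refine congrArg _ (funext fun ω => (hG k).1 fun i hi => ?_)
          simp [hca i hi]
      · refine Fin.lastCases ?_ fun k => ?_
        · simpa using hyg
        · simpa using hv' k
    intro W W' hW hW' s G hG a b ha hb haW hbW v v' hv hv'
    exact ⟨hall hW hW' s G hG a b ha hb haW hbW v v' hv hv',
      hall hW' hW s G hG b a hb ha hbW haW v' v hv' hv⟩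

/-- The span of a dense suborder is an elementary substructure of the span of the whole order. -/
theorem realize_span_univ_iff [LinearOrder I] [Nonempty A] (hV : IsOrderIndiscernible V)
    (hI : (Set.univ : Set I).SeparatesFinsets) (hW : W.SeparatesFinsets) {m : ℕ}
    (φ : L.BoundedFormula Empty m) (v : Fin m → span L V F W)
    (v' : Fin m → span L V F Set.univ) (hv : ∀ k, (v' k : (V : Filter (I → A)).Product fun _ => A)
      = v k) :
    φ.Realize default v ↔ φ.Realize default v' := by
  obtain ⟨s, hs, G, hG, hvG⟩ := exists_isTermOver_tuple fun k => (v k).2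
  have hvk := congrFun hvG
  exact realize_span_iff hV φ hW hI s G hG id id (strictMono_id.strictMonoOn _)
    (strictMono_id.strictMonoOn _) (fun i hi => hs hi) (fun _ _ => Set.mem_univ _) v v' hvk
    fun k => (hv k).trans (hvk k)

/-! ### The Tarski-Vaught test at bounded quantifier depth -/

variable (L V) in
/-- The Tarski-Vaught test for the span of `F` in the ultrapower, for formulas with fewer than `n`
nested quantifiers. The formulas are evaluated in the ultrapower. -/
def IsTarskiVaught (F : Set (List A → A)) (n : ℕ) : Prop :=
  ∀ (m : ℕ) (φ : L.BoundedFormula Empty (m + 1)), φ.quantifierDepth < n →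
    ∀ v : Fin m → (V : Filter (I → A)).Product fun _ => A, (∀ k, v k ∈ span L V F Set.univ) →
      (∀ y ∈ span L V F Set.univ, φ.Realize default (Fin.snoc v y)) →
        ∀ y, φ.Realize default (Fin.snoc v y)

theorem isTarskiVaught_zero : IsTarskiVaught L V F 0 :=
  fun _ _ h => absurd h (Nat.not_lt_zero _)

/-- The Tarski-Vaught test passes to dense suborders, by moving the support of a counterexample. -/
theorem IsTarskiVaught.realize_snoc [LinearOrder I] [Nonempty A]
    (hV : IsOrderIndiscernible V) {n : ℕ}
    (hF : IsTarskiVaught L V F n) (hW : W.SeparatesFinsets) {m : ℕ}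
    {φ : L.BoundedFormula Empty (m + 1)} (hφ : φ.quantifierDepth < n)
    {v : Fin m → (V : Filter (I → A)).Product fun _ => A} (hv : ∀ k, v k ∈ span L V F W)
    (H : ∀ y ∈ span L V F W, φ.Realize default (Fin.snoc v y)) :
    ∀ y, φ.Realize default (Fin.snoc v y) := by
  refine hF m φ hφ v (fun k => span_mono subset_rfl (Set.subset_univ _) (hv k)) fun y hy => ?_
  obtain ⟨s, hs, G, hG, rfl⟩ := exists_isTermOver_tuple hv
  obtain ⟨t, -, g, hg, rfl⟩ := exists_isTermOver hy
  obtain ⟨c, hc, hcs, hcW⟩ := hW.exists_extend s t id (strictMono_id.strictMonoOn _)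
    fun i hi => hs hi
  have h1 := H _ (hg.comp_mem_span fun i hi => hcW i (Finset.mem_union_right _ hi))
  have h2 := realize_toUltrapower_comp hV φ (s := s ∪ t)
    (G := Fin.snoc (α := fun _ => (I → A) → A) G g) (h := c) ?_ hc
  · rw [snoc_toUltrapower] at h2
    have h3 := snoc_toUltrapower (V := V) G g id
    simp only [Function.comp_id] at h3
    rw [h3] at h2
    refine h2.1 ?_
    convert h1 using 3 with k
    refine congrArg _ (funext fun ω => (hG k).1 fun i hi => ?_)
    simp [hcs i hi]
  · refine Fin.lastCases ?_ fun k => ?_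
    · simpa using (hg.mono subset_rfl Finset.subset_union_right).1
    · simpa using ((hG k).mono subset_rfl Finset.subset_union_left).1

theorem IsTarskiVaught.realize_iff [LinearOrder I] [Nonempty A]
    (hV : IsOrderIndiscernible V) {n : ℕ}
    (hF : IsTarskiVaught L V F n) (hW : W.SeparatesFinsets) {m : ℕ}
    (φ : L.BoundedFormula Empty m) (hφ : φ.quantifierDepth ≤ n) (v : Fin m → span L V F W) :
    φ.Realize default v ↔
      φ.Realize default fun k => (v k : (V : Filter (I → A)).Product fun _ => A) := by
  induction φ with
  | falsum => rfl
  | equal t₁ t₂ => exact realize_isQF_coe _ (BoundedFormula.IsAtomic.equal t₁ t₂).isQF v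
  | rel R ts => exact realize_isQF_coe _ (BoundedFormula.IsAtomic.rel R ts).isQF v
  | imp φ ψ ihφ ihψ =>
    rw [BoundedFormula.realize_imp, BoundedFormula.realize_imp,
      ihφ ((le_max_left _ _).trans hφ), ihψ ((le_max_right _ _).trans hφ)]
  | @all m φ ih =>
    have hφ' : φ.quantifierDepth < n := hφ
    rw [BoundedFormula.realize_all, BoundedFormula.realize_all]
    have key : ∀ y : span L V F W, φ.Realize default (Fin.snoc v y) ↔
        φ.Realize default (Fin.snoc (fun k => (v k : (V : Filter (I → A)).Product fun _ => A))
          (y : (V : Filter (I → A)).Product fun _ => A)) := by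
      intro y
      rw [ih hφ'.le]
      refine iff_of_eq (congrArg _ (funext (Fin.lastCases ?_ fun k => ?_))) <;> simp
    refine ⟨fun H => ?_, fun H y => (key y).2 (H y)⟩
    exact hF.realize_snoc hV hW hφ' (fun k => (v k).2) fun y hy => (key ⟨y, hy⟩).1 (H ⟨y, hy⟩)

theorem exists_mem_span_of_directed {ι : Type*} [Nonempty ι] {Fs : ι → Set (List A → A)}
    (hFs : Directed (· ⊆ ·) Fs) {x : (V : Filter (I → A)).Product fun _ => A}
    (hx : x ∈ span L V (⋃ i, Fs i) W) : ∃ i, x ∈ span L V (Fs i) W := by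
  refine Substructure.closure_induction (p := fun x => ∃ i, x ∈ span L V (Fs i) W) hx ?_ ?_
  · rintro x ⟨f, hf, l, hl, rfl⟩
    obtain ⟨i, hi⟩ := Set.mem_iUnion.1 hf
    exact ⟨i, toUltrapower_mem_span hi hl⟩
  · intro n g x hx
    choose i hi using hx
    obtain ⟨j, hj⟩ := hFs.finite_le i
    exact ⟨j, (span L V (Fs j) W).fun_mem g x fun k => span_mono (hj k) subset_rfl (hi k)⟩

theorem isTarskiVaught_iUnion {ι : Type*} [Nonempty ι] {Fs : ι → Set (List A → A)}
    (hFs : Directed (· ⊆ ·) Fs) {n : ℕ} (h : ∀ i, IsTarskiVaught L V (Fs i) n) :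
    IsTarskiVaught L V (⋃ i, Fs i) n := by
  intro m φ hφ v hv H
  choose i hi using fun k => exists_mem_span_of_directed hFs (hv k)
  obtain ⟨j, hj⟩ := hFs.finite_le i
  exact h j m φ hφ v (fun k => span_mono (hj k) subset_rfl (hi k)) fun y hy =>
    H y (span_mono (Set.subset_iUnion _ _) subset_rfl hy)

/-- If the Tarski-Vaught test fails, then an operation on `A` that gives counterexamples whenever
there are any shows this. -/
theorem exists_of_not_isTarskiVaught [Nonempty A] {n : ℕ} (h : ¬IsTarskiVaught L V F (n + 1)) :
    ∃ (σ : List A → A) (m : ℕ) (φ : L.BoundedFormula Empty (m + 1)) (s : Finset I)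
      (G : Fin m → (I → A) → A), φ.quantifierDepth ≤ n ∧ (∀ k, IsTermOver L V F s (G k)) ∧
      (∀ y ∈ span L V F Set.univ,
        φ.Realize default (Fin.snoc (fun k => toUltrapower V (G k)) y)) ∧
      ¬φ.Realize default (Fin.snoc (fun k => toUltrapower V (G k))
        (toUltrapower V fun ω => σ (s.toList.map ω))) := by
  classical
  unfold IsTarskiVaught at h
  push Not at h
  obtain ⟨m, φ, hφ, v, hv, H, y, hy⟩ := h
  obtain ⟨s, -, G, hG, rfl⟩ := exists_isTermOver_tuple hv
  obtain ⟨g, rfl⟩ := exists_toUltrapower_eq V y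
  let τ : (I → A) → A := fun ω =>
    Classical.epsilon fun a => ¬φ.Realize default (Fin.snoc (fun k => G k ω) a)
  have hτ : DependsOn τ s := fun ω ω' hω => by
    simp only [τ, fun k => (hG k).1 hω]
  -- An operation on lists recovers the arguments of `τ` from their values along `s.toList`.
  let σ : List A → A := fun l => τ fun i => l.getD (s.toList.idxOf i) (Classical.arbitrary A)
  have hσ : (fun ω : I → A => σ (s.toList.map ω)) = τ := by
    funext ω
    refine hτ fun i hi => ?_
    have hi' : i ∈ s.toList := Finset.mem_toList.2 hi
    have hlt := List.idxOf_lt_length_of_mem hi'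
    rw [List.getD_eq_getElem?_getD, List.getElem?_map, List.getElem?_eq_getElem hlt,
      List.getElem_idxOf]
    rfl
  have hsnoc : ∀ f : (I → A) → A, (φ.Realize default
      (Fin.snoc (fun k => toUltrapower V (G k)) (toUltrapower V f)) ↔
        ∀ᶠ ω in (V : Filter (I → A)), φ.Realize default (Fin.snoc (fun k => G k ω) (f ω))) := by
    intro f
    have h1 := snoc_toUltrapower (V := V) G f id
    simp only [Function.comp_id] at h1
    rw [← h1, realize_toUltrapower]
    refine iff_of_eq (congrArg (fun P => ∀ᶠ ω in (V : Filter (I → A)), P ω)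
      (funext fun ω => congrArg _ (funext (Fin.lastCases ?_ fun k => ?_)))) <;> simp
  refine ⟨σ, m, φ, s, G, Nat.lt_succ_iff.1 hφ, hG, H, ?_⟩
  rw [hsnoc, ← Ultrafilter.eventually_not] at hy
  rw [hσ, hsnoc, ← Ultrafilter.eventually_not]
  exact hy.mono fun ω hω => Classical.epsilon_spec
    (p := fun a => ¬φ.Realize default (Fin.snoc (fun k => G k ω) a)) ⟨_, hω⟩

end Ultrapower

end FirstOrder.Language

/-! ### Countable closed sets and chains of length `ω₁` -/

/-- The downward Löwenheim-Skolem argument for countable-valued finitary closure operations. -/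
theorem exists_countable_closed {X : Type*} (cl : Finset X → Set X)
    (hcl : ∀ t, (cl t).Countable) :
    ∃ C : Set X, C.Countable ∧ ∀ t : Finset X, ↑t ⊆ C → cl t ⊆ C := by
  let step : Set X → Set X := fun C => C ∪ ⋃ t ∈ {t : Finset X | ↑t ⊆ C}, cl t
  have hstep : ∀ C : Set X, C.Countable → (step C).Countable := by
    intro C hC
    refine hC.union (Set.Countable.biUnion ?_ fun t _ => hcl t)
    refine Set.Countable.preimage_of_injOn (Set.countable_ofPred_finite_subset hC)
      (f := fun t : Finset X => (t : Set X)) Finset.coe_injective.injOn |>.mono ?_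
    exact fun t ht => ⟨t.finite_toSet, ht⟩
  let D : ℕ → Set X := fun n => step^[n] ∅
  have hD : ∀ n, D (n + 1) = step (D n) := fun n => Function.iterate_succ_apply' step n ∅
  have hmono : Monotone D := monotone_nat_of_le_succ fun n => by
    rw [hD]; exact Set.subset_union_left
  refine ⟨⋃ n, D n, Set.countable_iUnion fun n => ?_, fun t ht => ?_⟩
  · induction n with
    | zero => exact Set.countable_empty
    | succ n ih => rw [hD]; exact hstep _ ih
  · obtain ⟨n, hn⟩ := hmono.directed_le.exists_mem_subset_of_finset_subset_biUnion ht
    refine Set.Subset.trans ?_ (Set.subset_iUnion D (n + 1))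
    rw [hD]
    exact (Set.subset_biUnion_of_mem (u := cl) (show t ∈ {t : Finset X | ↑t ⊆ D n} from hn)).trans
      Set.subset_union_right

theorem countable_Iic_ord_aleph_one (e : (Cardinal.aleph.{w} 1).ord.ToType) :
    (Set.Iic e).Countable := by
  have h := (Cardinal.mk_Iio_lt e (by simp)).trans_eq
    ((Cardinal.mk_toType _).trans ((Cardinal.card_ord _).trans Cardinal.succ_aleph0.symm))
  rw [Order.lt_succ_iff] at h
  have : (Set.Iio e).Countable := Cardinal.le_aleph0_iff_set_countable.1 h
  rw [← Set.Iio_insert]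
  exact this.insert e

/-- Iterating `next` along `ω₁`, with unions at limits. -/
theorem exists_chain_ord_aleph_one {S : Type*} (next : Set S → Set S) {F₀ : Set S}
    (hF₀ : F₀.Countable)
    (hnext : ∀ G, F₀ ⊆ G → G.Countable → G ⊆ next G ∧ (next G).Countable) :
    ∃ Fs : (Cardinal.aleph.{w} 1).ord.ToType → Set S,
      (∀ e, Fs e = next (F₀ ∪ ⋃ j : Set.Iio e, Fs j)) ∧ (∀ e, (Fs e).Countable) ∧
        (∀ e, F₀ ⊆ Fs e) ∧ Monotone Fs := by
  obtain ⟨Fs, hFs⟩ : ∃ Fs : (Cardinal.aleph.{w} 1).ord.ToType → Set S,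
      ∀ e, Fs e = next (F₀ ∪ ⋃ j : Set.Iio e, Fs j) :=
    ⟨wellFounded_lt.fix fun e ih => next (F₀ ∪ ⋃ j : Set.Iio e, ih j j.2),
      fun e => WellFounded.fix_eq _ _ _⟩
  have hunion : ∀ e, (∀ j < e, (Fs j).Countable) → (F₀ ∪ ⋃ j : Set.Iio e, Fs j).Countable := by
    intro e ih
    have : Countable (Set.Iio e) := ((countable_Iic_ord_aleph_one e).mono Set.Iio_subset_Iic_self)
    exact hF₀.union (Set.countable_iUnion fun j => ih j j.2)
  have hcount : ∀ e, (Fs e).Countable := by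
    intro e
    induction e using WellFoundedLT.induction with
    | ind e ih =>
      rw [hFs e]
      exact (hnext _ Set.subset_union_left (hunion e ih)).2
  have hsub : ∀ e, F₀ ∪ ⋃ j : Set.Iio e, Fs j ⊆ Fs e := by
    intro e
    conv_rhs => rw [hFs e]
    exact (hnext _ Set.subset_union_left (hunion e fun j _ => hcount j)).1
  refine ⟨Fs, hFs, hcount, fun e => Set.subset_union_left.trans (hsub e), fun i j hij => ?_⟩
  rcases hij.eq_or_lt with rfl | hij
  · exact subset_rfl
  · exact (Set.subset_iUnion (fun j : Set.Iio _ => Fs j) ⟨i, hij⟩).trans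
      (Set.subset_union_right.trans (hsub j))

namespace FirstOrder.Language

section Ultrapower

universe z

variable {L : Language.{u, v}} {A I : Type z} [L.Structure A] {V : Ultrafilter (I → A)}
  {F F' : Set (List A → A)} {W W' : Set I}

/-! ### Closing off an isomorphism between spans -/

theorem countable_generators (hF : F.Countable) (hW : W.Countable) :
    {x | ∃ f ∈ F, ∃ l : List I, (∀ i ∈ l, i ∈ W) ∧
      x = toUltrapower V fun ω => f (l.map ω)}.Countable := by
  have := hF.to_subtype
  have := hW.to_subtype
  refine (Set.countable_range fun p : F × List W =>
    toUltrapower V fun ω => (p.1 : List A → A) ((p.2.map Subtype.val).map ω)).mono ?_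
  rintro x ⟨f, hf, l, hl, rfl⟩
  lift l to List W using hl
  exact ⟨⟨⟨f, hf⟩, l⟩, rfl⟩

theorem exists_countable_subset_span {Y : Set ((V : Filter (I → A)).Product fun _ => A)}
    (hY : Y.Countable) {ι : Type*} [Nonempty ι] {Fs : ι → Set (List A → A)}
    (hFs : Directed (· ⊆ ·) Fs) :
    ∃ (D : Set ι) (W : Set I), D.Countable ∧ W.Countable ∧
      ∀ x ∈ Y, x ∈ span L V (⋃ i, Fs i) Set.univ → x ∈ span L V (⋃ i ∈ D, Fs i) W := by
  have : ∀ x, ∃ (i : ι) (s : Finset I),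
      x ∈ span L V (⋃ i, Fs i) Set.univ → x ∈ span L V (Fs i) s := by
    intro x
    by_cases hx : x ∈ span L V (⋃ i, Fs i) Set.univ
    · obtain ⟨i, hi⟩ := exists_mem_span_of_directed hFs hx
      obtain ⟨s, -, G, hG, rfl⟩ := exists_isTermOver hi
      exact ⟨i, s, fun _ => hG.mem_span subset_rfl⟩
    · exact ⟨Classical.arbitrary ι, ∅, fun h => absurd h hx⟩
  choose i s his using this
  refine ⟨i '' Y, ⋃ x ∈ Y, s x, hY.image i, hY.biUnion fun x _ => (s x).countable_toSet,
    fun x hx hxs => span_mono ?_ ?_ (his x hxs)⟩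
  · exact Set.subset_biUnion_of_mem (u := Fs) (Set.mem_image_of_mem i hx)
  · exact Set.subset_biUnion_of_mem (u := fun x => (s x : Set I)) hx

/-- A homomorphism that maps the generators of a span into `T` maps the whole span into `T`. -/
theorem hom_mem_of_mem_span (e : span L V F' Set.univ →[L] (V : Filter (I → A)).Product fun _ => A)
    (T : L.Substructure ((V : Filter (I → A)).Product fun _ => A)) (hF : F ⊆ F')
    (h : ∀ f ∈ F, ∀ l : List I, (∀ i ∈ l, i ∈ W) →
      ∀ hx : (toUltrapower V fun ω => f (l.map ω)) ∈ span L V F' Set.univ, e ⟨_, hx⟩ ∈ T)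
    {x} (hx : x ∈ span L V F W) (hx' : x ∈ span L V F' Set.univ) : e ⟨x, hx'⟩ ∈ T := by
  have hle : span L V F W ≤ (T.comap e).map (span L V F' Set.univ).subtype.toHom := by
    refine Substructure.closure_le.2 ?_
    rintro _ ⟨f, hf, l, hl, rfl⟩
    have hx := toUltrapower_mem_span (L := L) (V := V) (W := Set.univ) (hF hf) (l := l)
      fun _ _ => Set.mem_univ _
    exact ⟨⟨_, hx⟩, h f hf l hl hx, rfl⟩
  obtain ⟨y, hy, rfl⟩ := hle hx
  exact hy

/-- An isomorphism between the spans of `⋃ i, Fs i` and of a countable `F` carries the span of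
`⋃ j ∈ D, Fs j` over `W` onto the span of `F` over `W`, for some countable initial segment `D` of
the indices and some dense suborder `W`. -/
theorem exists_closed_of_equiv [LinearOrder I] [DenselyOrdered I] [NoMinOrder I] [NoMaxOrder I]
    [Nonempty I] {E : Type*} [LinearOrder E] [Nonempty E] (hE : ∀ j : E, (Set.Iic j).Countable)
    {Fs : E → Set (List A → A)} (hFs : Monotone Fs) (hc : ∀ j, (Fs j).Countable)
    (hF : F.Countable) (e : span L V (⋃ j, Fs j) Set.univ ≃[L] span L V F Set.univ) :
    ∃ (D : Set E) (W : Set I), D.Countable ∧ D.Nonempty ∧ IsLowerSet D ∧ W.SeparatesFinsets ∧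
      ∀ x (hx : x ∈ span L V (⋃ j, Fs j) Set.univ), x ∈ span L V (⋃ j ∈ D, Fs j) W ↔
        (e ⟨x, hx⟩ : (V : Filter (I → A)).Product fun _ => A) ∈ span L V F W := by
  classical
  have hsep : ∀ lo hi : Finset I, ∃ m, (∀ x ∈ lo, ∀ y ∈ hi, x < y) →
      (∀ x ∈ lo, x < m) ∧ ∀ y ∈ hi, m < y := by
    intro lo hi
    by_cases h : ∀ x ∈ lo, ∀ y ∈ hi, x < y
    · obtain ⟨m, hm⟩ := Order.exists_between_finsets lo hi h
      exact ⟨m, fun _ => hm⟩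
    · exact ⟨Classical.arbitrary I, fun h' => absurd h' h⟩
  choose sep hsep using hsep
  have hforth : ∀ (j : E) (r : Finset I), ∃ S : Set I, S.Countable ∧
      ∀ f ∈ Fs j, ∀ l : List I, (∀ i ∈ l, i ∈ r) →
        ∀ hx : (toUltrapower V fun ω => f (l.map ω)) ∈ span L V (⋃ j, Fs j) Set.univ,
          (e ⟨_, hx⟩ : (V : Filter (I → A)).Product fun _ => A) ∈ span L V F S := by
    intro j r
    let Y : Set (span L V (⋃ j, Fs j) Set.univ) := Subtype.val ⁻¹'
      {x | ∃ f ∈ Fs j, ∃ l : List I, (∀ i ∈ l, i ∈ (r : Set I)) ∧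
        x = toUltrapower V fun ω => f (l.map ω)}
    have hY : Y.Countable := Set.Countable.preimage_of_injOn
      (countable_generators (hc j) r.countable_toSet) Subtype.val_injective.injOn
    obtain ⟨_, S, _, hS, hYS⟩ := exists_countable_subset_span (L := L) (V := V)
      (hY.image fun x => (e x : (V : Filter (I → A)).Product fun _ => A))
      (Fs := fun _ : Unit => F) (fun _ _ => ⟨(), subset_rfl, subset_rfl⟩)
    refine ⟨S, hS, fun f hf l hl hx => ?_⟩
    have h1 := hYS _ (Set.mem_image_of_mem _ (show (⟨_, hx⟩ : span L V (⋃ j, Fs j) Set.univ) ∈ Y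
      from ⟨f, hf, l, hl, rfl⟩)) (span_mono (Set.subset_iUnion (fun _ : Unit => F) ()) subset_rfl
        (e ⟨_, hx⟩).2)
    exact span_mono (Set.iUnion₂_subset fun _ _ => subset_rfl) subset_rfl h1
  have hback : ∀ r : Finset I, ∃ (D : Set E) (S : Set I), D.Countable ∧ S.Countable ∧
      ∀ f ∈ F, ∀ l : List I, (∀ i ∈ l, i ∈ r) →
        ∀ hx : (toUltrapower V fun ω => f (l.map ω)) ∈ span L V F Set.univ,
          (e.symm ⟨_, hx⟩ : (V : Filter (I → A)).Product fun _ => A) ∈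
            span L V (⋃ j ∈ D, Fs j) S := by
    intro r
    let Y : Set (span L V F Set.univ) := Subtype.val ⁻¹'
      {x | ∃ f ∈ F, ∃ l : List I, (∀ i ∈ l, i ∈ (r : Set I)) ∧
        x = toUltrapower V fun ω => f (l.map ω)}
    have hY : Y.Countable := Set.Countable.preimage_of_injOn
      (countable_generators hF r.countable_toSet) Subtype.val_injective.injOn
    obtain ⟨D, S, hD, hS, hYS⟩ := exists_countable_subset_span (L := L) (V := V)
      (hY.image fun x => (e.symm x : (V : Filter (I → A)).Product fun _ => A))
      hFs.directed_le
    exact ⟨D, S, hD, hS, fun f hf l hl hx => hYS _ (Set.mem_image_of_mem _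
      (show (⟨_, hx⟩ : span L V F Set.univ) ∈ Y from ⟨f, hf, l, hl, rfl⟩)) (e.symm ⟨_, hx⟩).2⟩
  choose S hS hforth using hforth
  choose D' S' hD' hS' hback using hback
  -- The points added for a finite set of points already chosen, indices on the left.
  let cl : Finset (E ⊕ I) → Set (E ⊕ I) := fun t =>
    Sum.inl '' ({Classical.arbitrary E} ∪ (⋃ j ∈ t.toLeft, Set.Iic j) ∪ D' t.toRight) ∪
    Sum.inr '' (((fun p : Finset I × Finset I => sep p.1 p.2) ''
      (t.toRight.powerset ×ˢ t.toRight.powerset : Finset _)) ∪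
        (⋃ j ∈ t.toLeft, S j t.toRight) ∪ S' t.toRight)
  have hcl : ∀ t, (cl t).Countable := by
    intro t
    refine Set.Countable.union (Set.Countable.image ?_ _) (Set.Countable.image ?_ _)
    · exact ((Set.countable_singleton _).union
        (t.toLeft.countable_toSet.biUnion fun j _ => hE j)).union (hD' _)
    · exact (((Finset.countable_toSet _).image _).union
        (t.toLeft.countable_toSet.biUnion fun j _ => hS j _)).union (hS' _)
  obtain ⟨C, hC, hclC⟩ := exists_countable_closed cl hcl
  have hl : ∀ t : Finset (E ⊕ I), ↑t ⊆ C → ∀ j,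
      j ∈ ({Classical.arbitrary E} ∪ (⋃ j ∈ t.toLeft, Set.Iic j) ∪ D' t.toRight : Set E) →
        Sum.inl j ∈ C :=
    fun t ht j hj => hclC t ht (Or.inl (Set.mem_image_of_mem _ hj))
  have hr : ∀ t : Finset (E ⊕ I), ↑t ⊆ C → ∀ i,
      i ∈ (((fun p : Finset I × Finset I => sep p.1 p.2) ''
        (t.toRight.powerset ×ˢ t.toRight.powerset : Finset _)) ∪
          (⋃ j ∈ t.toLeft, S j t.toRight) ∪ S' t.toRight : Set I) → Sum.inr i ∈ C :=
    fun t ht i hi => hclC t ht (Or.inr (Set.mem_image_of_mem _ hi))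
  have hsubC : ∀ (q : Finset E) (r : Finset I), (∀ j ∈ q, Sum.inl j ∈ C) →
      (∀ i ∈ r, Sum.inr i ∈ C) → ↑(q.disjSum r) ⊆ C := by
    intro q r hq hr x hx
    rcases Finset.mem_disjSum.1 (Finset.mem_coe.1 hx) with ⟨j, hj, rfl⟩ | ⟨i, hi, rfl⟩
    · exact hq j hj
    · exact hr i hi
  have hfs : ∀ f ∈ ⋃ j ∈ Sum.inl ⁻¹' C, Fs j, ∀ l : List I, (∀ i ∈ l, i ∈ Sum.inr ⁻¹' C) →
      ∀ hx : (toUltrapower V fun ω => f (l.map ω)) ∈ span L V (⋃ j, Fs j) Set.univ,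
        (e ⟨_, hx⟩ : (V : Filter (I → A)).Product fun _ => A) ∈ span L V F (Sum.inr ⁻¹' C) := by
    intro f hf l hl hx
    obtain ⟨j, hj, hf⟩ := Set.mem_iUnion₂.1 hf
    refine span_mono subset_rfl (fun i hi => ?_)
      (hforth j l.toFinset f hf l (fun i hi => List.mem_toFinset.2 hi) hx)
    refine hr (({j} : Finset E).disjSum l.toFinset) (hsubC _ _ (by simpa using hj)
      (by simpa using hl)) i (Or.inl (Or.inr ?_))
    simpa using hi
  have hfs' : ∀ f ∈ F, ∀ l : List I, (∀ i ∈ l, i ∈ Sum.inr ⁻¹' C) →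
      ∀ hx : (toUltrapower V fun ω => f (l.map ω)) ∈ span L V F Set.univ,
        (e.symm ⟨_, hx⟩ : (V : Filter (I → A)).Product fun _ => A) ∈
          span L V (⋃ j ∈ Sum.inl ⁻¹' C, Fs j) (Sum.inr ⁻¹' C) := by
    intro f hf l hll hx
    have hsub := hsubC (∅ : Finset E) l.toFinset (by simp) (by simpa using hll)
    refine span_mono (Set.biUnion_subset_biUnion_left fun j hj => ?_) (fun i hi => ?_)
      (hback l.toFinset f hf l (fun i hi => List.mem_toFinset.2 hi) hx)
    · exact hl _ hsub j (Or.inr (by rwa [Finset.toRight_disjSum]))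
    · exact hr _ hsub i (Or.inr (by rwa [Finset.toRight_disjSum]))
  refine ⟨Sum.inl ⁻¹' C, Sum.inr ⁻¹' C, hC.preimage Sum.inl_injective,
    ⟨Classical.arbitrary E, hl ∅ (by simp) _ (by simp)⟩, ?_, ?_,
    fun x hx => ⟨fun h => ?_, fun h => ?_⟩⟩
  · intro j k hkj hj
    refine hl (({j} : Finset E).disjSum ∅) (hsubC _ _ (by simpa using hj) (by simp)) k
      (Or.inl (Or.inr ?_))
    simpa using hkj
  · intro lo hi hlo hhi h
    refine ⟨sep lo hi, ?_, hsep lo hi h⟩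
    refine hr ((∅ : Finset E).disjSum (lo ∪ hi)) (hsubC _ _ (by simp) ?_) _
      (Or.inl (Or.inl ⟨(lo, hi), ?_, rfl⟩))
    · intro i h
      rcases Finset.mem_union.1 h with h | h
      · exact hlo h
      · exact hhi h
    · rw [Finset.toRight_disjSum]
      exact Finset.mem_coe.2 (Finset.mem_product.2
        ⟨Finset.mem_powerset.2 Finset.subset_union_left,
          Finset.mem_powerset.2 Finset.subset_union_right⟩)
  · exact hom_mem_of_mem_span ((span L V F Set.univ).subtype.toHom.comp e.toHom) _
      (Set.iUnion₂_subset fun j _ => Set.subset_iUnion Fs j) hfs h hx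
  · have := hom_mem_of_mem_span
      ((span L V (⋃ j, Fs j) Set.univ).subtype.toHom.comp e.symm.toHom) _ subset_rfl hfs' h
      (e ⟨x, hx⟩).2
    simpa using this

theorem Embedding.realize_iff_of_surjective {M N : Type*} [L.Structure M] [L.Structure N]
    (f : M ↪[L] N) (hf : Function.Surjective f) {m : ℕ} (φ : L.BoundedFormula Empty m)
    (v : Fin m → M) : φ.Realize default v ↔ φ.Realize default (f ∘ v) := by
  let g : M ≃[L] N :=
    ⟨Equiv.ofBijective f ⟨f.injective, hf⟩, fun F x => f.map_fun F x, fun R x => f.map_rel R x⟩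
  have := StrongHomClass.realize_boundedFormula g φ (v := default) (xs := v)
  rw [← this]
  exact iff_of_eq (congrArg₂ _ (Subsingleton.elim _ _) rfl)

/-- A part of the span of `F'` that an isomorphism matches with the span of `F` over a dense
suborder is an elementary substructure. -/
theorem realize_iff_of_equiv [LinearOrder I] [Nonempty A] (hV : IsOrderIndiscernible V)
    (hI : (Set.univ : Set I).SeparatesFinsets) {G : Set (List A → A)} (hG : G ⊆ F')
    (hW : W.SeparatesFinsets) (e : span L V F' Set.univ ≃[L] span L V F Set.univ)
    (he : ∀ x (hx : x ∈ span L V F' Set.univ), x ∈ span L V G W ↔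
      (e ⟨x, hx⟩ : (V : Filter (I → A)).Product fun _ => A) ∈ span L V F W)
    {m : ℕ} (φ : L.BoundedFormula Empty m) (v : Fin m → span L V G W)
    (v' : Fin m → span L V F' Set.univ)
    (hv : ∀ k, (v' k : (V : Filter (I → A)).Product fun _ => A) = v k) :
    φ.Realize default v ↔ φ.Realize default v' := by
  have hle : span L V G W ≤ span L V F' Set.univ := span_mono hG (Set.subset_univ W)
  let f : span L V G W ↪[L] span L V F W :=
    (((span L V F Set.univ).subtype.comp e.toEmbedding).comp
      (Substructure.inclusion hle)).codRestrict _ fun x => (he x (hle x.2)).1 x.2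
  have hf : Function.Surjective f := by
    intro y
    have hy : (y : (V : Filter (I → A)).Product fun _ => A) ∈ span L V F Set.univ :=
      span_mono subset_rfl (Set.subset_univ W) y.2
    have hx := (he (e.symm ⟨y, hy⟩ : span L V F' Set.univ) (e.symm ⟨y, hy⟩).2).2 (by simp)
    refine ⟨⟨_, hx⟩, Subtype.ext ?_⟩
    change (e ⟨(e.symm ⟨y, hy⟩ : span L V F' Set.univ), _⟩ :
      (V : Filter (I → A)).Product fun _ => A) = y
    exact congrArg Subtype.val (e.apply_symm_apply ⟨y, hy⟩)
  rw [Embedding.realize_iff_of_surjective f hf,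
    realize_span_univ_iff hV hI hW φ _ (e ∘ v') fun k => ?_]
  · exact (Embedding.realize_iff_of_surjective e.toEmbedding e.surjective φ v').symm
  have : v' k = ⟨v k, hle (v k).2⟩ := Subtype.ext (hv k)
  rw [Function.comp_apply, this]
  rfl

end Ultrapower

end FirstOrder.Language

namespace FirstOrder.Language

section Ultrapower

universe z

variable {L : Language.{u, v}} {A I : Type z} [L.Structure A] {V : Ultrafilter (I → A)}

/-! ### Elementary spans from uniqueness -/

/-- If the spans of all sets of at most `ℵ₁` operations are isomorphic, then every countable set of
operations extends to a countable one whose span is elementary up to a given quantifier depth.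

Otherwise there is an `ω₁`-chain of countable sets that pass the Tarski-Vaught test at depth `n`,
while each limit of the chain fails it at depth `n + 1` and the next member of the chain shows the
failure. Inside the span of the union of the chain, some limit spans an elementary substructure,
because this is what happens in the isomorphic span of `F₀`; this contradicts the failure. -/
theorem exists_isTarskiVaught [LinearOrder I] [DenselyOrdered I] [NoMinOrder I] [NoMaxOrder I]
    [Nonempty I] [Nonempty A] (hV : IsOrderIndiscernible V) {F₀ : Set (List A → A)}
    (hF₀ : F₀.Countable)
    (hiso : ∀ F, F₀ ⊆ F → #F ≤ Cardinal.aleph 1 →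
      Nonempty (span L V F Set.univ ≃[L] span L V F₀ Set.univ)) (n : ℕ) :
    ∀ F, F₀ ⊆ F → F.Countable → ∃ F', F ⊆ F' ∧ F'.Countable ∧ IsTarskiVaught L V F' n := by
  classical
  have hI : (Set.univ : Set I).SeparatesFinsets := Set.separatesFinsets_univ
  induction n with
  | zero => exact fun F _ hF => ⟨F, subset_rfl, hF, isTarskiVaught_zero⟩
  | succ n ih =>
    intro F hF₀F hF
    by_contra! hbad
    -- `next G` contains a countable `G` and an operation showing that `G` fails the test.
    have hnext : ∀ G : Set (List A → A), ∃ N : Set (List A → A), F ⊆ G → G.Countable →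
        G ⊆ N ∧ N.Countable ∧ IsTarskiVaught L V N n ∧
        ∃ σ ∈ N, ∃ (m : ℕ) (φ : L.BoundedFormula Empty (m + 1)) (s : Finset I)
          (g : Fin m → (I → A) → A), φ.quantifierDepth ≤ n ∧ (∀ k, IsTermOver L V G s (g k)) ∧
          (∀ y ∈ span L V G Set.univ,
            φ.Realize default (Fin.snoc (fun k => toUltrapower V (g k)) y)) ∧
          ¬φ.Realize default (Fin.snoc (fun k => toUltrapower V (g k))
            (toUltrapower V fun ω => σ (s.toList.map ω))) := by
      intro G
      by_cases hG : F ⊆ G ∧ G.Countable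
      · obtain ⟨σ, m, φ, s, g, h⟩ := exists_of_not_isTarskiVaught (hbad G hG.1 hG.2)
        obtain ⟨N, hN, hNc, hNn⟩ := ih (insert σ G)
          ((hF₀F.trans hG.1).trans (Set.subset_insert _ _)) (hG.2.insert σ)
        exact ⟨N, fun _ _ => ⟨(Set.subset_insert _ _).trans hN, hNc, hNn, σ,
          hN (Set.mem_insert _ _), m, φ, s, g, h⟩⟩
      · exact ⟨G, fun h1 h2 => absurd ⟨h1, h2⟩ hG⟩
    choose next hnext using hnext
    obtain ⟨Fs, hFs, hFsc, hFFs, hmono⟩ := exists_chain_ord_aleph_one.{z} next hF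
      fun G h1 h2 => ⟨(hnext G h1 h2).1, (hnext G h1 h2).2.1⟩
    have hprev : ∀ j : (Cardinal.aleph.{z} 1).ord.ToType, (F ∪ ⋃ i : Set.Iio j, Fs i).Countable := by
      intro j
      have : Countable (Set.Iio j) := (countable_Iic_ord_aleph_one j).mono Set.Iio_subset_Iic_self
      exact hF.union (Set.countable_iUnion fun i => hFsc i.1)
    have hTV : ∀ j, IsTarskiVaught L V (Fs j) n := by
      intro j
      rw [hFs j]
      exact (hnext _ Set.subset_union_left (hprev j)).2.2.1
    have hcardE : #(Cardinal.aleph.{z} 1).ord.ToType = Cardinal.aleph 1 := by simp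
    have : Nonempty (Cardinal.aleph.{z} 1).ord.ToType := by
      rw [← Cardinal.mk_ne_zero_iff, hcardE]
      exact (Cardinal.aleph_pos 1).ne'
    have hcard : #(⋃ j, Fs j) ≤ Cardinal.aleph 1 := by
      refine Cardinal.mk_iUnion_le_sum_mk.trans ((Cardinal.sum_le_sum _ (fun _ => ℵ₀)
        fun j => (Cardinal.le_aleph0_iff_set_countable.2 (hFsc j))).trans ?_)
      rw [Cardinal.sum_const', hcardE]
      exact Cardinal.mul_le_of_le (Cardinal.aleph0_le_aleph 1) le_rfl (Cardinal.aleph0_le_aleph 1)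
    have hsub : ∀ j, Fs j ⊆ ⋃ j, Fs j := Set.subset_iUnion Fs
    obtain ⟨e⟩ := hiso (⋃ j, Fs j)
      (hF₀F.trans ((hFFs (Classical.arbitrary _)).trans (hsub _))) hcard
    -- Some countable initial segment of the chain spans an elementary substructure over `W`.
    obtain ⟨D, W, hDc, hDne, hDl, hW, heW⟩ := exists_closed_of_equiv
      countable_Iic_ord_aleph_one hmono hFsc hF₀ e
    -- The countable initial segment `D` consists of the predecessors of some `δ`.
    obtain ⟨δ, hδ⟩ : ∃ δ : (Cardinal.aleph.{z} 1).ord.ToType, D = Set.Iio δ := by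
      have hne : Dᶜ.Nonempty := by
        rw [Set.nonempty_compl]
        rintro rfl
        have := Cardinal.le_aleph0_iff_set_countable.2 hDc
        rw [Cardinal.mk_univ, hcardE] at this
        exact absurd this (not_le.2 Cardinal.aleph0_lt_aleph_one)
      obtain ⟨δ, hδ, hmin⟩ := wellFounded_lt.has_min Dᶜ hne
      refine ⟨δ, Set.ext fun j => ⟨fun hj => ?_, fun hj => ?_⟩⟩
      · exact lt_of_not_ge fun h => hδ (hDl h hj)
      · by_contra hjD
        exact hmin j hjD hj
    have hG : (⋃ j ∈ D, Fs j) = F ∪ ⋃ i : Set.Iio δ, Fs i := by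
      obtain ⟨j, hj⟩ := hDne
      rw [hδ, Set.biUnion_eq_iUnion, eq_comm, Set.union_eq_right]
      exact (hFFs j).trans (Set.subset_iUnion (fun i : Set.Iio δ => Fs i) ⟨j, hδ ▸ hj⟩)
    have hGTV : IsTarskiVaught L V (⋃ j ∈ D, Fs j) n := by
      rw [Set.biUnion_eq_iUnion]
      have := hDne.to_subtype
      exact isTarskiVaught_iUnion
        (hmono.comp (Subtype.mono_coe (· ∈ D))).directed_le fun j => hTV j
    have hUTV : IsTarskiVaught L V (⋃ j, Fs j) n :=
      isTarskiVaught_iUnion hmono.directed_le hTV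
    obtain ⟨-, -, -, σ, hσ, m, φ, s, g, hφ, hg, H, hnot⟩ :=
      hnext _ Set.subset_union_left (hprev δ)
    rw [← hFs δ] at hσ
    rw [← hG] at hg H
    -- The failure of the test is moved into the dense suborder `W`.
    obtain ⟨c, hc, -, hcW⟩ := hW.exists_extend ∅ s id (by simp [StrictMonoOn]) (by simp)
    rw [Finset.empty_union] at hc hcW
    have hy₀ : (toUltrapower V fun ω => σ (s.toList.map (ω ∘ c))) ∈
        span L V (⋃ j, Fs j) Set.univ := by
      have := toUltrapower_mem_span (L := L) (V := V) (W := Set.univ) (hsub δ hσ)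
        (l := s.toList.map c) fun _ _ => Set.mem_univ _
      simpa only [List.map_map] using this
    have hnot' : ¬φ.Realize default (Fin.snoc (fun k => toUltrapower V fun ω => g k (ω ∘ c))
        (toUltrapower V fun ω => σ (s.toList.map (ω ∘ c)))) := by
      have h1 := snoc_toUltrapower (V := V) g (fun ω => σ (s.toList.map ω)) id
      have h2 := snoc_toUltrapower (V := V) g (fun ω => σ (s.toList.map ω)) c
      simp only [Function.comp_id] at h1
      rw [← h2, realize_toUltrapower_comp hV φ (s := s) (Fin.lastCases ?_ fun k => ?_) hc, h1]
      · exact hnot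
      · simp only [Fin.snoc_last]
        intro ω ω' hω
        exact congrArg σ (List.map_congr_left fun i hi => hω i (Finset.mem_toList.1 hi))
      · simpa using (hg k).1
    let vW : Fin m → span L V (⋃ j ∈ D, Fs j) W := fun k =>
      ⟨_, (hg k).comp_mem_span hcW⟩
    have hle : span L V (⋃ j ∈ D, Fs j) W ≤ span L V (⋃ j, Fs j) Set.univ :=
      span_mono (Set.iUnion₂_subset fun j _ => hsub j) (Set.subset_univ W)
    have hallU : ¬φ.all.Realize default fun k => (⟨_, hle (vW k).2⟩ :
        span L V (⋃ j, Fs j) Set.univ) := by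
      intro hall
      have h1 := (hUTV.realize_iff hV hI φ hφ _).1 (hall ⟨_, hy₀⟩)
      refine hnot' ?_
      convert h1 using 2 with k
      refine Fin.lastCases ?_ (fun k => ?_) k <;> simp [vW]
    rw [← realize_iff_of_equiv hV hI (Set.iUnion₂_subset fun j _ => hsub j) hW e heW φ.all vW _
      fun k => rfl] at hallU
    rw [BoundedFormula.realize_all] at hallU
    push Not at hallU
    obtain ⟨y, hy⟩ := hallU
    rw [hGTV.realize_iff hV hW φ hφ] at hy
    obtain ⟨t, -, f, hf, hyf⟩ := exists_isTermOver y.2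
    -- The witness is moved back over the original parameters.
    obtain ⟨d, hd, hdc, -⟩ := hI.exists_extend_comp s t c id hc (strictMono_id.strictMonoOn _)
      fun _ _ => Set.mem_univ _
    have h1 := H _ (hf.comp_mem_span (h := d) fun _ _ => Set.mem_univ _)
    have h2 := snoc_toUltrapower (V := V) (fun k ω => g k (ω ∘ c)) f d
    have h3 := snoc_toUltrapower (V := V) (fun k ω => g k (ω ∘ c)) f id
    simp only [Function.comp_id] at h3
    have h4 : (fun k => toUltrapower V (g k)) =
        fun k => toUltrapower V fun ω => g k ((ω ∘ d) ∘ c) := by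
      funext k
      refine congrArg _ (funext fun ω => (hg k).1 fun i hi => ?_)
      simp [hdc i hi]
    rw [h4, ← h2, realize_toUltrapower_comp hV φ (Fin.lastCases ?_ fun k => ?_) hd, h3] at h1
    · refine hy ?_
      convert h1 using 2 with k
      refine Fin.lastCases ?_ (fun k => ?_) k
      · simpa using hyf
      · simp [vW]
    · simpa using (hf.mono subset_rfl (Finset.subset_union_right (s₁ := s.image c))).1
    · simpa using (((hg k).comp c).mono subset_rfl Finset.subset_union_left).1

end Ultrapower

/-- All infinite models of a `κ`-unique universal theory are elementarily equivalent to its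
strictly `κ`-generated model. -/
theorem Theory.realize_iff_of_isUnique {L : Language.{u, v}} {T : L.Theory} (hT : T.IsUniversal)
    {κ : Cardinal.{max u v w}} (hκ : ℵ₀ < κ) {M : Theory.ModelType.{u, v, max u v w} T}
    (hM : ∀ N : Theory.ModelType.{u, v, max u v w} T, L.IsStrictlyGenerated N κ →
      Nonempty (N ≃[L] M))
    {A : Type (max u v w)} [L.Structure A] [A ⊨ T] [Infinite A] (φ : L.Sentence) :
    A ⊨ φ ↔ M ⊨ φ := by
  classical
  -- A dense linear order without end points of cardinality `κ`.
  let I : Type (max u v w) := κ.ord.ToType ×ₗ ℚ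
  have hκI : #I = κ := by
    have : #I = #(κ.ord.ToType × ℚ) := Cardinal.mk_congr ofLex
    rw [this, Cardinal.mk_prod]
    simp only [Cardinal.mk_toType, Cardinal.card_ord, Cardinal.mkRat, Cardinal.lift_aleph0,
      Cardinal.lift_uzero]
    exact Cardinal.mul_aleph0_eq hκ.le
  have : Nonempty I := by
    rw [← Cardinal.mk_ne_zero_iff, hκI]
    exact (Cardinal.aleph0_pos.trans hκ).ne'
  obtain ⟨V, hV⟩ := exists_isOrderIndiscernible A I
  let head : List A → A := fun l => l.headD (Classical.arbitrary A)
  have hmodel : (V : Filter (I → A)).Product (fun _ => A) ⊨ T := by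
    refine (Theory.model_iff _).2 fun ψ hψ => ?_
    rw [Ultraproduct.sentence_realize]
    exact Filter.Eventually.of_forall fun _ => Theory.realize_sentence_of_mem T hψ
  have hequiv : ∀ F : Set (List A → A), {head} ⊆ F → #F ≤ κ →
      Nonempty (span L V F Set.univ ≃[L] M) := by
    intro F hF hFκ
    have hgen := isStrictlyGenerated_span (L := L) hV hκ hκI hFκ
      ⟨head, hF (Set.mem_singleton _), fun _ => rfl⟩
    have : Nonempty (span L V F Set.univ) :=
      ⟨⟨_, toUltrapower_mem_span (hF (Set.mem_singleton _)) (l := []) (by simp)⟩⟩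
    exact hM (Theory.ModelType.of T (span L V F Set.univ)) hgen
  have hκ₁ : Cardinal.aleph 1 ≤ κ := by
    rw [← Cardinal.succ_aleph0]
    exact Order.succ_le_of_lt hκ
  obtain ⟨F, hF, hFc, hFn⟩ := exists_isTarskiVaught (L := L) hV (Set.countable_singleton head)
    (fun F hF hF₁ => by
      obtain ⟨e⟩ := hequiv F hF (hF₁.trans hκ₁)
      obtain ⟨e'⟩ := hequiv {head} subset_rfl (by simpa using Cardinal.one_le_aleph0.trans hκ.le)
      exact ⟨e'.symm.comp e⟩)
    (BoundedFormula.quantifierDepth φ) {head} subset_rfl (Set.countable_singleton head)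
  obtain ⟨e⟩ := hequiv F hF ((Cardinal.le_aleph0_iff_set_countable.2 hFc).trans hκ.le)
  have h1 : span L V F Set.univ ⊨ φ ↔ (V : Filter (I → A)).Product (fun _ => A) ⊨ φ := by
    have := hFn.realize_iff hV Set.separatesFinsets_univ φ le_rfl default
    exact this.trans (iff_of_eq (congrArg (BoundedFormula.Realize φ default)
      (Subsingleton.elim _ _)))
  rw [← StrongHomClass.realize_sentence e φ, h1, Ultraproduct.sentence_realize,
    Filter.eventually_const]

end FirstOrder.Language

open FirstOrder.Language in
theorem theorem5 {L : FirstOrder.Language.{u, v}} (T : L.Theory) (hT : T.IsUniversal)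
    (κ : Cardinal.{max u v w}) (hκ : Cardinal.aleph0 < κ)
    (huniq : FirstOrder.Language.Theory.IsUniqueInPower.{u, v, w} T κ) :
    T.theoryOfInfiniteModels.IsComplete := by
  obtain ⟨M, hMgen, hM⟩ := huniq
  have hMinf : Infinite M := by
    by_contra hfin
    rw [not_infinite_iff_finite] at hfin
    have hle : κ ≤ #(Set.univ : Set M) := hMgen.2 ⟨Set.univ, Substructure.closure_univ, rfl⟩
    rw [Cardinal.mk_univ] at hle
    exact absurd (hle.trans_lt (Cardinal.lt_aleph0_of_finite M)) (not_lt.2 hκ.le)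
  have key : ∀ (A : Theory.ModelType.{u, v, max u v} T), Infinite A → ∀ φ : L.Sentence,
      A ⊨ φ ↔ M ⊨ φ := by
    intro A hA φ
    let _ : L.Structure (ULift.{w} A) := Equiv.ulift.symm.inducedStructure
    let e : A ≃[L] ULift.{w} A := Equiv.ulift.symm.inducedStructureEquiv
    have : ULift.{w} A ⊨ T := StrongHomClass.theory_model e
    rw [StrongHomClass.realize_sentence e φ]
    exact Theory.realize_iff_of_isUnique.{u, v, w} hT hκ hM φ
  obtain ⟨N, hMN, hN⟩ := exists_elementarilyEquivalent_card_eq L M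
    (max (ℵ₀ : Cardinal.{max u v}) L.card) (le_max_left _ _) (by simp)
  have hNT : N ⊨ T := hMN.theory_model_iff.1 inferInstance
  have hNinf : Infinite N := Cardinal.infinite_iff.2 (hN ▸ le_max_left _ _)
  have hNsat : N ⊨ T.theoryOfInfiniteModels :=
    (Theory.model_iff _).2 fun φ hφ => hφ (Theory.ModelType.of T N) hNinf
  refine ⟨⟨Theory.ModelType.of _ N⟩, fun φ => ?_⟩
  by_cases h : M ⊨ φ
  · exact Or.inl (Theory.models_sentence_of_mem fun A hA => (key A hA φ).2 h)
  · refine Or.inr (Theory.models_sentence_of_mem fun A hA => (key A hA φ.not).2 ?_)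
    exact (Sentence.realize_not M).2 h
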